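/- Let $A\in\mathbb R^{n\times n}$, $B_w\in\mathbb R^{n\times n_z}$, $B\in\mathbb R^{n\times n_d}$, $C_z\in\mathbb R^{n_z\times n}$, $D_{zw}\in\mathbb R^{n_z\times n_z}$, $D_{zd}\in\mathbb R^{n_z\times n_d}$, $C\in\mathbb R^{n_e\times n}$, $D_{ew}\in\mathbb R^{n_e\times n_z}$, $D\in\mathbb R^{n_e\times n_d}$ be the matrices of an interconnection $x(t+1)=Ax(t)+B_ww(t)+Bd(t)$, $z(t)=C_zx(t)+D_{zw}w(t)+D_{zd}d(t)$, $e(t)=Cx(t)+D_{ew}w(t)+Dd(t)$ (where $w(t)=z(t)$ at impulse instants and $w(t)=0$ otherwise), let $A_\Psi\in\mathbb R^{n_\xi\times n_\xi}$, $B_\Psi\in\mathbb R^{n_\xi\times 2n_z}$, $C_\Psi\in\mathbb R^{m\times n_\xi}$, $D_\Psi\in\mathbb R^{m\times 2n_z}$ describe a filter, let $1\le T_{\min}\le T_{\max}$ be integers, and let $P=\begin{pmatrix}Q&S\\S^\top&R\end{pmatrix}\in\mathbb R^{(n_e+n_d)\times(n_e+n_d)}$ be symmetric and nonsingular with $Q\succcurlyeq0$.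 Write $(\bullet)^\top WT:=T^\top WT$. For matrices $F,G,H,L$ (flow) and $F_J,G_J,H_J,L_J$ (jump), symmetric $Y,N$ and $k\ge1$, let $$\mathcal L_k\Big(Y,N;\begin{smallmatrix}F&G\\H&L\end{smallmatrix};\begin{smallmatrix}F_J&G_J\\H_J&L_J\end{smallmatrix}\Big):=(\bullet)^\top\begin{pmatrix}Y&0&0\\0&-Y&0\\0&0&I_{k+1}\otimes N\end{pmatrix}\begin{pmatrix}F_JF^k&F_JF^{k-1}G&F_JF^{k-2}G&\cdots&F_JG&G_J\\ I&0&0&\cdots&0&0\\ H&L&0&\cdots&0&0\\ HF&HG&L&&&\vdots\\ \vdots&\vdots&&\ddots&&\vdots\\ HF^{k-1}&HF^{k-2}G&HF^{k-3}G&\cdots&L&0\\ H_JF^k&H_JF^{k-1}G&H_JF^{k-2}G&\cdots&H_JG&L_J\end{pmatrix}.$$ Suppose that there exist symmetric matrices $X\in\mathbb R^{(n_\xi+n)\times(n_\xi+n)}$, $M\in\mathbb R^{m\times m}$, $Z\in\mathbb R^{n_\xi\times n_\xi}$ satisfying the IQC and lifting based LMIs $$(\bullet)^\top\begin{pmatr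ix}X&0&0&0\\0&-X&0&0\\0&0&M&0\\0&0&0&P\end{pmatrix}\begin{pmatrix}A_\Psi&B_\Psi\left(\begin{smallmatrix}C_z\\0\end{smallmatrix}\right)&B_\Psi\left(\begin{smallmatrix}D_{zw}\\I\end{smallmatrix}\right)&B_\Psi\left(\begin{smallmatrix}D_{zd}\\0\end{smallmatrix}\right)\\0&A&B_w&B\\I&0&0&0\\0&I&0&0\\C_\Psi&D_\Psi\left(\begin{smallmatrix}C_z\\0\end{smallmatrix}\right)&D_\Psi\left(\begin{smallmatrix}D_{zw}\\I\end{smallmatrix}\right)&D_\Psi\left(\begin{smallmatrix}D_{zd}\\0\end{smallmatrix}\right)\\0&C&D_{ew}&D\\0&0&0&I\end{pmatrix}\prec0,\qquad X-\begin{pmatrix}Z&0\\0&0\end{pmatrix}\succ0,$$ $$\mathcal L_k\Big(Z,M;\begin{smallmatrix}A_\Psi&B_\Psi E_0\\C_\Psi&D_\Psi E_0\end{smallmatrix};\begin{smallmatrix}A_\Psi&B_\Psi E_1\\C_\Psi&D_\Psi E_1\end{smallmatrix}\Big)\succcurlyeq0\quad\text{for all integers }k\in[T_{\min},T_{\max}],\qquad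 E_0:=\begin{pmatrix}I\\0\end{pmatrix},\ E_1:=\begin{pmatrix}I\\I\end{pmatrix}.$$ Then $I-D_{zw}$ is nonsingular and, with $$\begin{pmatrix}A_J&B_J\\C_J&D_J\end{pmatrix}:=\begin{pmatrix}A&B\\C&D\end{pmatrix}+\begin{pmatrix}B_w\\D_{ew}\end{pmatrix}(I-D_{zw})^{-1}\begin{pmatrix}C_z&D_{zd}\end{pmatrix},$$ the lifting based LMIs are feasible: there exists a symmetric $\hat X\in\mathbb R^{n\times n}$ with $\hat X\succ0$ and, for all integers $k\in[T_{\min},T_{\max}]$, $$\mathcal L_k\bigg(\hat X,P;\begin{array}{cc}A&B\\\left(\begin{smallmatrix}C\\0\end{smallmatrix}\right)&\left(\begin{smallmatrix}D\\I\end{smallmatrix}\right)\end{array};\begin{array}{cc}A_J&B_J\\\left(\begin{smallmatrix}C_J\\0\end{smallmatrix}\right)&\left(\begin{smallmatrix}D_J\\I\end{smallmatrix}\right)\end{array}\bigg)\prec0 .$$ -/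

import Mathlib

open scoped Matrix Kronecker

/-- The congruence `(•)ᵀ W T = Tᵀ W T`. -/
def congruence {r c : Type*} [Fintype r] (W : Matrix r r ℝ) (T : Matrix r c ℝ) : Matrix c c ℝ :=
  Tᵀ * W * T

/-- `W ≺ 0`: the real matrix `W` is symmetric and negative definite. -/
def NegDef {r : Type*} (W : Matrix r r ℝ) : Prop := (-W).PosDef

section Lifting

variable {n d p : Type*} [Fintype n] [DecidableEq n]

/-- The lifted state map over one period of an impulsive system which flows with `(A, B)` in the
first `k` steps and jumps with `(AJ, BJ)` in the last one:
`[AJ A ^ k, AJ A ^ (k-1) B, AJ A ^ (k-2) B, …, AJ B, BJ]`.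
The first block column belongs to the initial state and the block column `j = 0, …, k` to the
input at step `j`. -/
def liftState (k : ℕ) (A : Matrix n n ℝ) (B : Matrix n d ℝ) (AJ : Matrix n n ℝ)
    (BJ : Matrix n d ℝ) : Matrix n (n ⊕ Fin (k + 1) × d) ℝ :=
  Matrix.fromCols (AJ * A ^ k)
    (Matrix.of fun a jb =>
      if (jb.1 : ℕ) < k then (AJ * A ^ (k - 1 - jb.1) * B) a jb.2 else BJ a jb.2)

/-- The lifted output map over the same period, for the output map `(C, D)` in the first `k`
steps and `(CJ, DJ)` in the last one. Block row `i < k` is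
`[C A ^ i, C A ^ (i-1) B, …, C B, D, 0, …, 0]` and block row `k` is
`[CJ A ^ k, CJ A ^ (k-1) B, …, CJ B, DJ]`. -/
def liftOutput (k : ℕ) (A : Matrix n n ℝ) (B : Matrix n d ℝ) (C : Matrix p n ℝ)
    (D : Matrix p d ℝ) (CJ : Matrix p n ℝ) (DJ : Matrix p d ℝ) :
    Matrix (Fin (k + 1) × p) (n ⊕ Fin (k + 1) × d) ℝ :=
  let Cat : ℕ → Matrix p n ℝ := fun i => if i < k then C else CJ
  let Dat : ℕ → Matrix p d ℝ := fun i => if i < k then D else DJ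
  Matrix.fromCols
    (Matrix.of fun ia b => (Cat ia.1 * A ^ (ia.1 : ℕ)) ia.2 b)
    (Matrix.of fun ia jb =>
      if jb.1 < ia.1 then (Cat ia.1 * A ^ ((ia.1 : ℕ) - 1 - jb.1) * B) ia.2 jb.2
      else if jb.1 = ia.1 then Dat ia.1 ia.2 jb.2
      else 0)

/-- The left-hand side of a lifted dissipation inequality with storage matrix `X` and supply rate
matrix `M`:
`(•)ᵀ diag(X, -X, I_{k+1} ⊗ M) [liftState; [I, 0]; liftOutput]`. -/
noncomputable def liftedLMI [Fintype p] (k : ℕ) (X : Matrix n n ℝ) (M : Matrix p p ℝ)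
    (A : Matrix n n ℝ) (B : Matrix n d ℝ) (C : Matrix p n ℝ) (D : Matrix p d ℝ)
    (AJ : Matrix n n ℝ) (BJ : Matrix n d ℝ) (CJ : Matrix p n ℝ) (DJ : Matrix p d ℝ) :
    Matrix (n ⊕ Fin (k + 1) × d) (n ⊕ Fin (k + 1) × d) ℝ :=
  congruence
    (Matrix.fromBlocks (Matrix.fromBlocks X 0 0 (-X)) 0 0
      ((1 : Matrix (Fin (k + 1)) (Fin (k + 1)) ℝ) ⊗ₖ M))
    (Matrix.fromRows
      (Matrix.fromRows (liftState k A B AJ BJ) (Matrix.fromCols 1 0))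
      (liftOutput k A B C D CJ DJ))

end Lifting

section Tests

variable {n nξ nz nd ne m : ℕ}

/-- Feasibility of the lifting based LMIs for the impulsive system with flow `(A, B, C, D)` and
jump `(AJ, BJ, CJ, DJ)`: there is a symmetric `X ≻ 0` with, for all `Tmin ≤ k ≤ Tmax`,
`(•)ᵀ diag(X, -X, I_{k+1} ⊗ P) [AJ A ^ k, …, AJ B, BJ; I, 0, …, 0; C, D, 0, …; 0, I, 0, …; …;
CJ A ^ k, CJ A ^ (k-1) B, …, CJ B, DJ; 0, …, 0, I] ≺ 0`.
The outer factor arises from lifting the output `(e, d)`, i.e. the output maps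
`[C; 0], [D; I]` (flow) and `[CJ; 0], [DJ; I]` (jump). -/
def LiftingLMIsFeasible (Tmin Tmax : ℕ)
    (A : Matrix (Fin n) (Fin n) ℝ) (B : Matrix (Fin n) (Fin nd) ℝ)
    (C : Matrix (Fin ne) (Fin n) ℝ) (D : Matrix (Fin ne) (Fin nd) ℝ)
    (AJ : Matrix (Fin n) (Fin n) ℝ) (BJ : Matrix (Fin n) (Fin nd) ℝ)
    (CJ : Matrix (Fin ne) (Fin n) ℝ) (DJ : Matrix (Fin ne) (Fin nd) ℝ)
    (P : Matrix (Fin ne ⊕ Fin nd) (Fin ne ⊕ Fin nd) ℝ) : Prop :=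
  ∃ X : Matrix (Fin n) (Fin n) ℝ, X.PosDef ∧
    ∀ k : ℕ, Tmin ≤ k → k ≤ Tmax →
      NegDef (liftedLMI k X P
        A B (Matrix.fromRows C 0) (Matrix.fromRows D 1)
        AJ BJ (Matrix.fromRows CJ 0) (Matrix.fromRows DJ 1))

/-- The left-hand side of the main LMI of the IQC theorem for the interconnection augmented by the
filter: the congruence of `diag(X, -X, M, P)` by the outer factor whose block columns belong to
`(ξ, x)`, `w` and `d`. -/
noncomputable def iqcMainLMI
    (A : Matrix (Fin n) (Fin n) ℝ) (Bw : Matrix (Fin n) (Fin nz) ℝ)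
    (B : Matrix (Fin n) (Fin nd) ℝ)
    (Cz : Matrix (Fin nz) (Fin n) ℝ) (Dzw : Matrix (Fin nz) (Fin nz) ℝ)
    (Dzd : Matrix (Fin nz) (Fin nd) ℝ)
    (C : Matrix (Fin ne) (Fin n) ℝ) (Dew : Matrix (Fin ne) (Fin nz) ℝ)
    (D : Matrix (Fin ne) (Fin nd) ℝ)
    (AΨ : Matrix (Fin nξ) (Fin nξ) ℝ) (BΨ : Matrix (Fin nξ) (Fin nz ⊕ Fin nz) ℝ)
    (CΨ : Matrix (Fin m) (Fin nξ) ℝ) (DΨ : Matrix (Fin m) (Fin nz ⊕ Fin nz) ℝ)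
    (P : Matrix (Fin ne ⊕ Fin nd) (Fin ne ⊕ Fin nd) ℝ)
    (X : Matrix (Fin nξ ⊕ Fin n) (Fin nξ ⊕ Fin n) ℝ) (M : Matrix (Fin m) (Fin m) ℝ) :
    Matrix ((Fin nξ ⊕ Fin n) ⊕ (Fin nz ⊕ Fin nd)) ((Fin nξ ⊕ Fin n) ⊕ (Fin nz ⊕ Fin nd)) ℝ :=
  let Uz : Matrix (Fin nz ⊕ Fin nz) (Fin n) ℝ := Matrix.fromRows Cz 0
  let Uw : Matrix (Fin nz ⊕ Fin nz) (Fin nz) ℝ := Matrix.fromRows Dzw 1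
  let Ud : Matrix (Fin nz ⊕ Fin nz) (Fin nd) ℝ := Matrix.fromRows Dzd 0
  congruence
    (Matrix.fromBlocks (Matrix.fromBlocks X 0 0 (-X)) 0 0 (Matrix.fromBlocks M 0 0 P))
    (Matrix.fromRows
      (Matrix.fromRows
        -- next augmented state
        (Matrix.fromCols (Matrix.fromBlocks AΨ (BΨ * Uz) 0 A)
          (Matrix.fromBlocks (BΨ * Uw) (BΨ * Ud) Bw B))
        -- current augmented state
        (Matrix.fromCols 1 0))
      (Matrix.fromRows
        -- filter output
        (Matrix.fromCols (Matrix.fromCols CΨ (DΨ * Uz)) (Matrix.fromCols (DΨ * Uw) (DΨ * Ud)))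
        -- performance output and disturbance
        (Matrix.fromCols (Matrix.fromBlocks 0 C 0 0) (Matrix.fromBlocks Dew D 0 1))))

/-- Feasibility of the IQC and lifting based LMIs with the filter `(AΨ, BΨ, CΨ, DΨ)`: there are
symmetric `X, M, Z` satisfying the main LMI, the lifted multiplier LMI (for `Tmin ≤ k ≤ Tmax`) and
`X - diag(Z, 0) ≻ 0`. The multiplier LMI is the nonstrict lifted dissipation inequality for the
filter driven by `(z, 0)` in the first `k` steps and by `(z, z)` in the last step. -/
def IQCLiftingLMIsFeasible (Tmin Tmax : ℕ)
    (A : Matrix (Fin n) (Fin n) ℝ) (Bw : Matrix (Fin n) (Fin nz) ℝ)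
    (B : Matrix (Fin n) (Fin nd) ℝ)
    (Cz : Matrix (Fin nz) (Fin n) ℝ) (Dzw : Matrix (Fin nz) (Fin nz) ℝ)
    (Dzd : Matrix (Fin nz) (Fin nd) ℝ)
    (C : Matrix (Fin ne) (Fin n) ℝ) (Dew : Matrix (Fin ne) (Fin nz) ℝ)
    (D : Matrix (Fin ne) (Fin nd) ℝ)
    (AΨ : Matrix (Fin nξ) (Fin nξ) ℝ) (BΨ : Matrix (Fin nξ) (Fin nz ⊕ Fin nz) ℝ)
    (CΨ : Matrix (Fin m) (Fin nξ) ℝ) (DΨ : Matrix (Fin m) (Fin nz ⊕ Fin nz) ℝ)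
    (P : Matrix (Fin ne ⊕ Fin nd) (Fin ne ⊕ Fin nd) ℝ) : Prop :=
  let E₀ : Matrix (Fin nz ⊕ Fin nz) (Fin nz) ℝ := Matrix.fromRows 1 0
  let E₁ : Matrix (Fin nz ⊕ Fin nz) (Fin nz) ℝ := Matrix.fromRows 1 1
  ∃ (X : Matrix (Fin nξ ⊕ Fin n) (Fin nξ ⊕ Fin n) ℝ) (M : Matrix (Fin m) (Fin m) ℝ)
    (Z : Matrix (Fin nξ) (Fin nξ) ℝ),
    X.IsSymm ∧ M.IsSymm ∧ Z.IsSymm ∧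
    NegDef (iqcMainLMI A Bw B Cz Dzw Dzd C Dew D AΨ BΨ CΨ DΨ P X M) ∧
    (∀ k : ℕ, Tmin ≤ k → k ≤ Tmax →
      (liftedLMI k Z M AΨ (BΨ * E₀) CΨ (DΨ * E₀) AΨ (BΨ * E₁) CΨ (DΨ * E₁)).PosSemidef) ∧
    (X - Matrix.fromBlocks Z 0 0 0).PosDef

end Tests

/-!
Every matrix inequality is read as an inequality for its quadratic form along trajectories. For the
main LMI this form is the one-step increment of the storage `X` at `(ξ, x)` plus the supplies `M` of
the filter output and `P` of `(e, d)` (`quad_iqcMainLMI`). For a lifted LMI it is the increment of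
the storage over a whole period plus the supply accumulated in it (`quad_liftedLMI`).

Nonsingularity of `1 - Dzw`: if `w = Dzw w` with `w ≠ 0`, an impulse `w` at zero state and
disturbance makes the filter input `(w, w)`, so the main LMI and `0 ≼ P₁₁` make
`X (BΨ (w, w), Bw w) + M (DΨ (w, w))` negative. The multiplier LMI with this impulse in the last
step gives `0 ≤ Z (BΨ (w, w)) + M (DΨ (w, w))`, which contradicts `diag(Z, 0) ≺ X`
(`isUnit_det_one_sub_of_iqcLMIs`).

Lifted LMIs: take an initial state and disturbance of the impulsive system, with `w = 0` in the flow
steps and `w = z` in the last step, and drive the filter from any initial state by `(z, w)`. Summing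
the main LMI over the period and subtracting the multiplier LMI eliminates the supply `M` and
leaves a dissipation inequality with storage `W := X - diag(Z, 0) ≻ 0` on `(ξ, x)`. The certificate
is the Schur complement `V x := min_ξ W (ξ, x)` (`Matrix.PosDef.exists_partial_minimum`): start the
filter at the minimizer, so that `W = V` initially, and use `V ≤ W` at the end of the period. The
inequality is strict because some step has a nonzero state or disturbance.
-/

/-! ### Quadratic forms and partial minimization -/

/-- The quadratic form `v ↦ vᵀ W v` of a square real matrix. -/
def quad {r : Type*} [Fintype r] (W : Matrix r r ℝ) (v : r → ℝ) : ℝ := v ⬝ᵥ W *ᵥ v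

section QuadraticForms

variable {r s : Type*} [Fintype r] [Fintype s]

lemma quad_congruence (W : Matrix r r ℝ) (T : Matrix r s ℝ) (v : s → ℝ) :
    quad (congruence W T) v = quad W (T *ᵥ v) := by
  simp only [quad, congruence, ← Matrix.mulVec_mulVec, Matrix.dotProduct_mulVec,
    Matrix.vecMul_transpose]

lemma quad_fromBlocks_diagonal (W : Matrix r r ℝ) (V : Matrix s s ℝ) (x : r → ℝ) (y : s → ℝ) :
    quad (Matrix.fromBlocks W 0 0 V) (Sum.elim x y) = quad W x + quad V y := by
  simp [quad, Matrix.fromBlocks_mulVec]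

@[simp] lemma quad_neg (W : Matrix r r ℝ) (v : r → ℝ) : quad (-W) v = -quad W v := by
  simp [quad, Matrix.neg_mulVec]

@[simp] lemma quad_sub (W V : Matrix r r ℝ) (v : r → ℝ) :
    quad (W - V) v = quad W v - quad V v := by
  simp [quad, Matrix.sub_mulVec]

@[simp] lemma quad_zero_right (W : Matrix r r ℝ) : quad W 0 = 0 := by simp [quad]

@[simp] lemma quad_zero_left (v : r → ℝ) : quad (0 : Matrix r r ℝ) v = 0 := by simp [quad]

lemma Matrix.PosDef.quad_pos {W : Matrix r r ℝ} (hW : W.PosDef) {v : r → ℝ} (hv : v ≠ 0) :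
    0 < quad W v := by
  simpa [quad] using hW.dotProduct_mulVec_pos hv

lemma Matrix.PosSemidef.quad_nonneg {W : Matrix r r ℝ} (hW : W.PosSemidef) (v : r → ℝ) :
    0 ≤ quad W v := by
  simpa [quad] using hW.dotProduct_mulVec_nonneg v

lemma NegDef.quad_neg {W : Matrix r r ℝ} (hW : NegDef W) {v : r → ℝ} (hv : v ≠ 0) :
    quad W v < 0 := by
  simpa using hW.quad_pos hv

lemma NegDef.quad_nonpos {W : Matrix r r ℝ} (hW : NegDef W) (v : r → ℝ) : quad W v ≤ 0 := by
  simpa using hW.posSemidef.quad_nonneg v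

lemma Matrix.PosDef.of_quad_pos {W : Matrix r r ℝ} (hW : W.IsSymm)
    (h : ∀ v, v ≠ 0 → 0 < quad W v) : W.PosDef :=
  Matrix.PosDef.of_dotProduct_mulVec_pos (by simpa [Matrix.IsHermitian] using hW.eq)
    fun {v} hv => by simpa [quad] using h v hv

lemma NegDef.of_quad_neg {W : Matrix r r ℝ} (hW : W.IsSymm)
    (h : ∀ v, v ≠ 0 → quad W v < 0) : NegDef W :=
  Matrix.PosDef.of_quad_pos hW.neg fun v hv => by simpa using h v hv

omit [Fintype s] in
lemma Matrix.IsSymm.congruence {W : Matrix r r ℝ} (hW : W.IsSymm) (T : Matrix r s ℝ) :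
    (congruence W T).IsSymm := by
  simp only [Matrix.IsSymm, _root_.congruence, Matrix.transpose_mul, Matrix.transpose_transpose,
    hW.eq, Matrix.mul_assoc]

lemma quad_one_kronecker [DecidableEq s] (M : Matrix r r ℝ) (y : s → r → ℝ) :
    quad ((1 : Matrix s s ℝ) ⊗ₖ M) (fun ia => y ia.1 ia.2) = ∑ i, quad M (y i) := by
  simp only [quad, dotProduct, Matrix.mulVec, Fintype.sum_prod_type, Matrix.kroneckerMap_apply,
    Matrix.one_apply, ite_mul, one_mul, zero_mul]
  refine Finset.sum_congr rfl fun i _ => Finset.sum_congr rfl fun a _ => ?_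
  congr 1
  rw [Finset.sum_comm]
  simp

/-- Partial minimization of a positive definite quadratic form over the first block of variables
yields a positive definite quadratic form (its matrix is a Schur complement), and the minimum is
attained. -/
lemma Matrix.PosDef.exists_partial_minimum [DecidableEq r] [DecidableEq s]
    {W : Matrix (r ⊕ s) (r ⊕ s) ℝ} (hW : W.PosDef) :
    ∃ V : Matrix s s ℝ, V.PosDef ∧
      (∀ y x, quad V x ≤ quad W (Sum.elim y x)) ∧
      ∀ x, ∃ y, quad W (Sum.elim y x) = quad V x := by
  have hsymm : Wᵀ = W := by simpa [Matrix.IsHermitian] using hW.isHermitian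
  have hunit : IsUnit W.toBlocks₁₁.det := by
    have : W.toBlocks₁₁.PosDef := hW.submatrix Sum.inl_injective
    exact this.det_pos.ne'.isUnit
  let K : Matrix r s ℝ := -(W.toBlocks₁₁⁻¹ * W.toBlocks₁₂)
  let T : Matrix (r ⊕ s) s ℝ := Matrix.fromRows K 1
  have hT : ∀ x, T *ᵥ x = Sum.elim (K *ᵥ x) x := fun x => by simp [T, Matrix.fromRows_mulVec]
  have hquad : ∀ x, quad (congruence W T) x = quad W (Sum.elim (K *ᵥ x) x) := fun x => by
    rw [quad_congruence, hT]
  refine ⟨congruence W T, .of_quad_pos (Matrix.IsSymm.congruence hsymm T) fun x hx => ?_,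
    fun y x => ?_, fun x => ⟨K *ᵥ x, (hquad x).symm⟩⟩
  · rw [hquad]
    exact hW.quad_pos fun h => hx (funext fun i => by simpa using congrFun h (Sum.inr i))
  · rw [hquad]
    -- The minimizer makes the first block of the gradient vanish, so the cross term disappears.
    have hgrad : W *ᵥ Sum.elim (K *ᵥ x) x =
        Sum.elim (0 : r → ℝ) (W.toBlocks₂₁ *ᵥ K *ᵥ x + W.toBlocks₂₂ *ᵥ x) := by
      conv_lhs => rw [← Matrix.fromBlocks_toBlocks W]
      rw [Matrix.fromBlocks_mulVec]
      congr 1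
      simp [K, Matrix.mulVec_mulVec, Matrix.neg_mulVec, Matrix.mulVec_neg, ← Matrix.mul_assoc,
        Matrix.mul_nonsing_inv _ hunit]
    set v := Sum.elim (K *ᵥ x) x with hv
    set e : r ⊕ s → ℝ := Sum.elim (y - K *ᵥ x) 0 with he
    have hsum : Sum.elim y x = v + e := by
      ext (i | i) <;> simp [hv, he]
    have hev : e ⬝ᵥ W *ᵥ v = 0 := by
      rw [hgrad, he]; simp
    have hve : v ⬝ᵥ W *ᵥ e = 0 := by
      rw [Matrix.dotProduct_mulVec, ← Matrix.mulVec_transpose, hsymm, dotProduct_comm, hev]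
    have hnn := hW.posSemidef.quad_nonneg e
    have : quad W (v + e) = quad W v + quad W e := by
      simp only [quad, Matrix.mulVec_add, dotProduct_add, add_dotProduct, hev, hve]
      ring
    rw [hsum, this]
    linarith

end QuadraticForms

/-! ### Lifting along trajectories -/

section LiftedTrajectories

variable {n d p : Type*} [Fintype n] [DecidableEq n] [Fintype d]

omit [Fintype n] [DecidableEq n] in
/-- A matrix row made of consecutive row blocks, applied to the stacked vector of the `u j`. -/
lemma mulVec_stacked_apply {r r' ι : Type*} [Fintype ι] {N : Matrix r (ι × d) ℝ}
    {M : ι → Matrix r' d ℝ} {a : r} {a' : r'} (h : ∀ j b, N a (j, b) = M j a' b)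
    (u : ι → d → ℝ) : (N *ᵥ fun jb => u jb.1 jb.2) a = (∑ j, M j *ᵥ u j) a' := by
  simp [Matrix.mulVec, dotProduct, Fintype.sum_prod_type, Finset.sum_apply, h]

/-- Variation of constants for `x (t + 1) = A x t + B u t`. -/
lemma state_eq_of_recursion {k : ℕ} {A : Matrix n n ℝ} {B : Matrix n d ℝ} {x : ℕ → n → ℝ}
    {u : ℕ → d → ℝ} (h : ∀ t < k, x (t + 1) = A *ᵥ x t + B *ᵥ u t) {t : ℕ} (ht : t ≤ k) :
    x t = A ^ t *ᵥ x 0 + ∑ j ∈ Finset.range t, (A ^ (t - 1 - j) * B) *ᵥ u j := by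
  induction t with
  | zero => simp
  | succ t ih =>
    rw [h t ht, ih (by omega), Finset.sum_range_succ, Matrix.mulVec_add, Matrix.mulVec_mulVec,
      ← pow_succ', add_assoc, Matrix.mulVec_sum]
    congr 2
    · refine Finset.sum_congr rfl fun j hj => ?_
      rw [Finset.mem_range] at hj
      rw [Matrix.mulVec_mulVec, ← Matrix.mul_assoc, ← pow_succ',
        show t + 1 - 1 - j = t - 1 - j + 1 by omega]
    · simp

lemma liftState_mulVec {k : ℕ} {A AJ : Matrix n n ℝ} {B BJ : Matrix n d ℝ} {x : ℕ → n → ℝ}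
    {u : ℕ → d → ℝ} (h : ∀ t < k, x (t + 1) = A *ᵥ x t + B *ᵥ u t) :
    liftState k A B AJ BJ *ᵥ Sum.elim (x 0) (fun jb => u jb.1 jb.2) =
      AJ *ᵥ x k + BJ *ᵥ u k := by
  ext a
  rw [liftState, Matrix.fromCols_mulVec_sumElim, Pi.add_apply,
    mulVec_stacked_apply (a' := a) (u := fun j : Fin (k + 1) => u j)
      (M := fun j : Fin (k + 1) => if (j : ℕ) < k then AJ * A ^ (k - 1 - j) * B else BJ)
      (fun j b => by rw [Matrix.of_apply]; split_ifs <;> rfl),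
    ← Pi.add_apply, Fin.sum_univ_castSucc, state_eq_of_recursion h le_rfl, Matrix.mulVec_add,
    Matrix.mulVec_mulVec, Matrix.mulVec_sum, Finset.sum_range, add_assoc]
  simp [Matrix.mul_assoc]

lemma liftOutput_mulVec {k : ℕ} {A : Matrix n n ℝ} {B : Matrix n d ℝ} {C CJ : Matrix p n ℝ}
    {D DJ : Matrix p d ℝ} {x : ℕ → n → ℝ} {u : ℕ → d → ℝ}
    (h : ∀ t < k, x (t + 1) = A *ᵥ x t + B *ᵥ u t) :
    liftOutput k A B C D CJ DJ *ᵥ Sum.elim (x 0) (fun jb => u jb.1 jb.2) =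
      fun ia : Fin (k + 1) × p =>
        ((if (ia.1 : ℕ) < k then C else CJ) *ᵥ x ia.1 +
          (if (ia.1 : ℕ) < k then D else DJ) *ᵥ u ia.1) ia.2 := by
  ext ⟨i, a⟩
  -- Naming the output maps active in row `i` leaves only the case split on the block columns.
  obtain ⟨E, hE⟩ : ∃ E, E = if (i : ℕ) < k then C else CJ := ⟨_, rfl⟩
  obtain ⟨F, hF⟩ : ∃ F, F = if (i : ℕ) < k then D else DJ := ⟨_, rfl⟩
  have hrow : (liftOutput k A B C D CJ DJ *ᵥ Sum.elim (x 0) (fun jb => u jb.1 jb.2)) (i, a) =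
      ((E * A ^ (i : ℕ)) *ᵥ x 0 + ∑ j : Fin (k + 1), (if j < i then E * A ^ ((i : ℕ) - 1 - j) * B
        else if j = i then F else 0) *ᵥ u j) a := by
    rw [liftOutput, Matrix.fromCols_mulVec_sumElim, Pi.add_apply,
      mulVec_stacked_apply (a' := a) (u := fun j : Fin (k + 1) => u j)
        (M := fun j => if j < i then E * A ^ ((i : ℕ) - 1 - j) * B else if j = i then F else 0)
        (fun j b => by
          simp only [Matrix.of_apply]
          rw [← hE, ← hF]
          split_ifs <;> rfl),
      Pi.add_apply]
    simp only [Matrix.mulVec, Matrix.of_apply]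
    rw [← hE]
  rw [hrow]
  simp only [← hE, ← hF]
  refine congrFun ?_ a
  have hsum : ∑ j : Fin (k + 1), (if j < i then E * A ^ ((i : ℕ) - 1 - j) * B
      else if j = i then F else 0) *ᵥ u j =
      (∑ j ∈ Finset.range i, (E * A ^ ((i : ℕ) - 1 - j) * B) *ᵥ u j) + F *ᵥ u i := by
    have hi : (i : ℕ) + 1 ≤ k + 1 := i.2
    have := Finset.sum_range (n := k + 1) (fun j => (if j < (i : ℕ) then
      E * A ^ ((i : ℕ) - 1 - j) * B else if j = i then F else 0) *ᵥ u j)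
    simp only [Fin.lt_def, Fin.ext_iff]
    rw [← this, ← Finset.sum_subset (Finset.range_mono hi), Finset.sum_range_succ]
    · congr 1
      · refine Finset.sum_congr rfl fun j hj => ?_
        rw [if_pos (Finset.mem_range.1 hj)]
      · simp
    · intro j _ hj
      rw [Finset.mem_range] at hj
      rw [if_neg (by omega), if_neg (by omega), Matrix.zero_mulVec]
  rw [hsum, state_eq_of_recursion h (Nat.lt_succ_iff.1 i.2), Matrix.mulVec_add,
    Matrix.mulVec_mulVec, Matrix.mulVec_sum, add_assoc]
  simp [Matrix.mul_assoc]

/-- The quadratic form of the lifted matrix, at the initial state and the inputs of a trajectory,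
is the increment of the storage over the period plus the accumulated supply. -/
lemma quad_liftedLMI [Fintype p] {k : ℕ} {A AJ : Matrix n n ℝ} {B BJ : Matrix n d ℝ}
    {C CJ : Matrix p n ℝ} {D DJ : Matrix p d ℝ} (X : Matrix n n ℝ) (M : Matrix p p ℝ)
    {x : ℕ → n → ℝ} {u : ℕ → d → ℝ} (h : ∀ t < k, x (t + 1) = A *ᵥ x t + B *ᵥ u t) :
    quad (liftedLMI k X M A B C D AJ BJ CJ DJ) (Sum.elim (x 0) fun jb => u jb.1 jb.2) =
      quad X (AJ *ᵥ x k + BJ *ᵥ u k) - quad X (x 0) +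
        (∑ t ∈ Finset.range k, quad M (C *ᵥ x t + D *ᵥ u t) + quad M (CJ *ᵥ x k + DJ *ᵥ u k)) := by
  rw [liftedLMI, quad_congruence, Matrix.fromRows_mulVec, Matrix.fromRows_mulVec,
    liftState_mulVec h, liftOutput_mulVec h, quad_fromBlocks_diagonal, quad_fromBlocks_diagonal,
    quad_one_kronecker (y := fun i : Fin (k + 1) => (if (i : ℕ) < k then C else CJ) *ᵥ x i +
      (if (i : ℕ) < k then D else DJ) *ᵥ u i), Fin.sum_univ_castSucc, Finset.sum_range]
  simp [sub_eq_add_neg]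

omit [Fintype d] in
lemma liftedLMI_isSymm [Fintype p] (k : ℕ) {X : Matrix n n ℝ} {M : Matrix p p ℝ}
    (hX : X.IsSymm) (hM : M.IsSymm) (A AJ : Matrix n n ℝ) (B BJ : Matrix n d ℝ)
    (C CJ : Matrix p n ℝ) (D DJ : Matrix p d ℝ) :
    (liftedLMI k X M A B C D AJ BJ CJ DJ).IsSymm := by
  refine Matrix.IsSymm.congruence ?_ _
  refine Matrix.IsSymm.fromBlocks (Matrix.IsSymm.fromBlocks hX (by simp) hX.neg) (by simp) ?_
  rw [Matrix.IsSymm, ← Matrix.kroneckerMap_transpose, Matrix.transpose_one, hM.eq]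

end LiftedTrajectories

/-! ### The filtered interconnection -/

section Interconnection

variable {n nξ nz nd ne m : ℕ}

/-- The quadratic form of the main LMI is the one-step increment of the storage plus the supplies
of the filter output and of the performance channel. -/
lemma quad_iqcMainLMI
    (A : Matrix (Fin n) (Fin n) ℝ) (Bw : Matrix (Fin n) (Fin nz) ℝ)
    (B : Matrix (Fin n) (Fin nd) ℝ)
    (Cz : Matrix (Fin nz) (Fin n) ℝ) (Dzw : Matrix (Fin nz) (Fin nz) ℝ)
    (Dzd : Matrix (Fin nz) (Fin nd) ℝ)
    (C : Matrix (Fin ne) (Fin n) ℝ) (Dew : Matrix (Fin ne) (Fin nz) ℝ)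
    (D : Matrix (Fin ne) (Fin nd) ℝ)
    (AΨ : Matrix (Fin nξ) (Fin nξ) ℝ) (BΨ : Matrix (Fin nξ) (Fin nz ⊕ Fin nz) ℝ)
    (CΨ : Matrix (Fin m) (Fin nξ) ℝ) (DΨ : Matrix (Fin m) (Fin nz ⊕ Fin nz) ℝ)
    (P : Matrix (Fin ne ⊕ Fin nd) (Fin ne ⊕ Fin nd) ℝ)
    (X : Matrix (Fin nξ ⊕ Fin n) (Fin nξ ⊕ Fin n) ℝ) (M : Matrix (Fin m) (Fin m) ℝ)
    (ξ : Fin nξ → ℝ) (x : Fin n → ℝ) (w z : Fin nz → ℝ) (d : Fin nd → ℝ)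
    (hz : z = Cz *ᵥ x + Dzw *ᵥ w + Dzd *ᵥ d) :
    quad (iqcMainLMI A Bw B Cz Dzw Dzd C Dew D AΨ BΨ CΨ DΨ P X M)
        (Sum.elim (Sum.elim ξ x) (Sum.elim w d)) =
      quad X (Sum.elim (AΨ *ᵥ ξ + BΨ *ᵥ Sum.elim z w) (A *ᵥ x + Bw *ᵥ w + B *ᵥ d)) -
        quad X (Sum.elim ξ x) +
        (quad M (CΨ *ᵥ ξ + DΨ *ᵥ Sum.elim z w) +
          quad P (Sum.elim (C *ᵥ x + Dew *ᵥ w + D *ᵥ d) d)) := by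
  obtain ⟨Uz, hUz⟩ : ∃ U : Matrix (Fin nz ⊕ Fin nz) (Fin n) ℝ, U = Matrix.fromRows Cz 0 :=
    ⟨_, rfl⟩
  obtain ⟨Uw, hUw⟩ : ∃ U : Matrix (Fin nz ⊕ Fin nz) (Fin nz) ℝ, U = Matrix.fromRows Dzw 1 :=
    ⟨_, rfl⟩
  obtain ⟨Ud, hUd⟩ : ∃ U : Matrix (Fin nz ⊕ Fin nz) (Fin nd) ℝ, U = Matrix.fromRows Dzd 0 :=
    ⟨_, rfl⟩
  have hin : Uz *ᵥ x + (Uw *ᵥ w + Ud *ᵥ d) = Sum.elim z w := by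
    rw [hz, hUz, hUw, hUd]
    ext (i | i) <;> simp [Matrix.fromRows_mulVec, add_assoc]
  have hnext : Matrix.fromBlocks AΨ (BΨ * Uz) 0 A *ᵥ Sum.elim ξ x +
      Matrix.fromBlocks (BΨ * Uw) (BΨ * Ud) Bw B *ᵥ Sum.elim w d =
      Sum.elim (AΨ *ᵥ ξ + BΨ *ᵥ Sum.elim z w) (A *ᵥ x + Bw *ᵥ w + B *ᵥ d) := by
    rw [← hin, Matrix.fromBlocks_mulVec, Matrix.fromBlocks_mulVec, ← Sum.elim_add_add]
    simp only [Sum.elim_comp_inl, Sum.elim_comp_inr, Matrix.mulVec_mulVec, Matrix.mulVec_add,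
      Matrix.zero_mulVec, zero_add, add_assoc]
  have hfilter : Matrix.fromCols CΨ (DΨ * Uz) *ᵥ Sum.elim ξ x +
      Matrix.fromCols (DΨ * Uw) (DΨ * Ud) *ᵥ Sum.elim w d =
      CΨ *ᵥ ξ + DΨ *ᵥ Sum.elim z w := by
    rw [← hin, Matrix.fromCols_mulVec_sumElim, Matrix.fromCols_mulVec_sumElim]
    simp only [Matrix.mulVec_mulVec, Matrix.mulVec_add, add_assoc]
  have hperf : Matrix.fromBlocks 0 C 0 0 *ᵥ Sum.elim ξ x +
      Matrix.fromBlocks Dew D 0 1 *ᵥ Sum.elim w d =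
      (Sum.elim (C *ᵥ x + Dew *ᵥ w + D *ᵥ d) d : Fin ne ⊕ Fin nd → ℝ) := by
    rw [Matrix.fromBlocks_mulVec, Matrix.fromBlocks_mulVec, ← Sum.elim_add_add]
    simp [add_assoc]
  simp only [iqcMainLMI, quad_congruence, ← hUz, ← hUw, ← hUd]
  rw [Matrix.fromRows_mulVec, Matrix.fromRows_mulVec, Matrix.fromRows_mulVec]
  simp only [Matrix.fromCols_mulVec_sumElim _ _ (Sum.elim ξ x)]
  rw [hnext, hfilter, hperf]
  simp only [quad_fromBlocks_diagonal, Matrix.one_mulVec, Matrix.zero_mulVec, add_zero, quad_neg,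
    sub_eq_add_neg]

/-- Nonsingularity of `1 - Dzw`: a nonzero `w = Dzw w` would enter the filter as `(w, w)`, so that
the main LMI and `0 ≼ P₁₁` make the increment of `X` plus the filter supply negative, while the
lifted multiplier LMI, tested with this impulse in the last step of a period, and `diag(Z, 0) ≺ X`
make it nonnegative. -/
lemma isUnit_det_one_sub_of_iqcLMIs {k : ℕ}
    {A : Matrix (Fin n) (Fin n) ℝ} {Bw : Matrix (Fin n) (Fin nz) ℝ}
    {B : Matrix (Fin n) (Fin nd) ℝ}
    {Cz : Matrix (Fin nz) (Fin n) ℝ} {Dzw : Matrix (Fin nz) (Fin nz) ℝ}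
    {Dzd : Matrix (Fin nz) (Fin nd) ℝ}
    {C : Matrix (Fin ne) (Fin n) ℝ} {Dew : Matrix (Fin ne) (Fin nz) ℝ}
    {D : Matrix (Fin ne) (Fin nd) ℝ}
    {AΨ : Matrix (Fin nξ) (Fin nξ) ℝ} {BΨ : Matrix (Fin nξ) (Fin nz ⊕ Fin nz) ℝ}
    {CΨ : Matrix (Fin m) (Fin nξ) ℝ} {DΨ : Matrix (Fin m) (Fin nz ⊕ Fin nz) ℝ}
    {P : Matrix (Fin ne ⊕ Fin nd) (Fin ne ⊕ Fin nd) ℝ} (hQ : P.toBlocks₁₁.PosSemidef)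
    {X : Matrix (Fin nξ ⊕ Fin n) (Fin nξ ⊕ Fin n) ℝ} {M : Matrix (Fin m) (Fin m) ℝ}
    {Z : Matrix (Fin nξ) (Fin nξ) ℝ} {E₀ E₁ : Matrix (Fin nz ⊕ Fin nz) (Fin nz) ℝ}
    (hE₁ : E₁ = Matrix.fromRows 1 1)
    (hmain : NegDef (iqcMainLMI A Bw B Cz Dzw Dzd C Dew D AΨ BΨ CΨ DΨ P X M))
    (hmult : (liftedLMI k Z M AΨ (BΨ * E₀) CΨ (DΨ * E₀)
      AΨ (BΨ * E₁) CΨ (DΨ * E₁)).PosSemidef)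
    (hX : (X - Matrix.fromBlocks Z 0 0 0).PosDef) :
    IsUnit (1 - Dzw).det := by
  rw [isUnit_iff_ne_zero]
  intro hdet
  obtain ⟨w, hw, hker⟩ := Matrix.exists_mulVec_eq_zero_iff.2 hdet
  have hDw : Dzw *ᵥ w = w := by
    rw [Matrix.sub_mulVec, Matrix.one_mulVec, sub_eq_zero] at hker
    exact hker.symm
  have hne : Sum.elim (Sum.elim (0 : Fin nξ → ℝ) (0 : Fin n → ℝ))
      (Sum.elim w (0 : Fin nd → ℝ)) ≠ 0 :=
    fun h => hw (funext fun i => by simpa using congrFun h (Sum.inr (Sum.inl i)))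
  have h₁ := hmain.quad_neg hne
  rw [quad_iqcMainLMI (z := w) (hz := by simp [hDw])] at h₁
  have h₂ := hmult.quad_nonneg (Sum.elim (0 : Fin nξ → ℝ) fun jb : Fin (k + 1) × Fin nz =>
    (if (jb.1 : ℕ) < k then 0 else w : Fin nz → ℝ) jb.2)
  rw [quad_liftedLMI (x := fun _ => (0 : Fin nξ → ℝ)) (u := fun t => if t < k then 0 else w)
    _ _ (fun t ht => by simp [ht])] at h₂
  have hsum : ∑ t ∈ Finset.range k, quad M (CΨ *ᵥ (0 : Fin nξ → ℝ) +
      (DΨ * E₀) *ᵥ (if t < k then 0 else w : Fin nz → ℝ)) = 0 :=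
    Finset.sum_eq_zero fun t ht => by simp [Finset.mem_range.1 ht]
  have hP : 0 ≤ quad P (Sum.elim (Dew *ᵥ w) 0) := by
    have h := hQ.quad_nonneg (Dew *ᵥ w)
    rw [← Matrix.fromBlocks_toBlocks P]
    simpa [quad, Matrix.fromBlocks_mulVec] using h
  have hXZ := hX.posSemidef.quad_nonneg (Sum.elim (BΨ *ᵥ Sum.elim w w) (Bw *ᵥ w))
  rw [quad_sub, quad_fromBlocks_diagonal] at hXZ
  have hE₁w : E₁ *ᵥ w = Sum.elim w w := by simp [hE₁, Matrix.fromRows_mulVec]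
  have hzero : (Sum.elim 0 0 : Fin nξ ⊕ Fin n → ℝ) = 0 := by simp
  rw [hsum] at h₂
  simp only [lt_irrefl, if_false, Matrix.mulVec_zero, zero_add, add_zero, quad_zero_right,
    quad_zero_left, sub_zero, hzero, ← Matrix.mulVec_mulVec, hE₁w] at h₁ h₂ hXZ
  linarith

lemma exists_sequence_of_step {V : Type*} (f : ℕ → V → V) (x₀ : V) :
    ∃ x : ℕ → V, x 0 = x₀ ∧ ∀ t, x (t + 1) = f t (x t) :=
  ⟨fun t => Nat.rec x₀ f t, rfl, fun _ => rfl⟩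

end Interconnection

/-! ### Feasibility of the lifted LMIs -/

theorem mainTheorem6 {n nξ nz nd ne m : ℕ} (Tmin Tmax : ℕ) (hT₀ : 0 < Tmin) (hT : Tmin ≤ Tmax)
    (A : Matrix (Fin n) (Fin n) ℝ) (Bw : Matrix (Fin n) (Fin nz) ℝ)
    (B : Matrix (Fin n) (Fin nd) ℝ)
    (Cz : Matrix (Fin nz) (Fin n) ℝ) (Dzw : Matrix (Fin nz) (Fin nz) ℝ)
    (Dzd : Matrix (Fin nz) (Fin nd) ℝ)
    (C : Matrix (Fin ne) (Fin n) ℝ) (Dew : Matrix (Fin ne) (Fin nz) ℝ)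
    (D : Matrix (Fin ne) (Fin nd) ℝ)
    (AΨ : Matrix (Fin nξ) (Fin nξ) ℝ) (BΨ : Matrix (Fin nξ) (Fin nz ⊕ Fin nz) ℝ)
    (CΨ : Matrix (Fin m) (Fin nξ) ℝ) (DΨ : Matrix (Fin m) (Fin nz ⊕ Fin nz) ℝ)
    (P : Matrix (Fin ne ⊕ Fin nd) (Fin ne ⊕ Fin nd) ℝ)
    (hPsymm : P.IsSymm) (hQ : P.toBlocks₁₁.PosSemidef) (hP : IsUnit P.det)
    (AJ : Matrix (Fin n) (Fin n) ℝ) (BJ : Matrix (Fin n) (Fin nd) ℝ)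
    (CJ : Matrix (Fin ne) (Fin n) ℝ) (DJ : Matrix (Fin ne) (Fin nd) ℝ)
    (hJ : Matrix.fromBlocks AJ BJ CJ DJ =
      Matrix.fromBlocks A B C D +
        Matrix.fromRows Bw Dew * (1 - Dzw)⁻¹ * Matrix.fromCols Cz Dzd)
    (hfeas : IQCLiftingLMIsFeasible Tmin Tmax A Bw B Cz Dzw Dzd C Dew D AΨ BΨ CΨ DΨ P) :
    IsUnit (1 - Dzw).det ∧
      LiftingLMIsFeasible Tmin Tmax A B C D AJ BJ CJ DJ P := by
  obtain ⟨X, M, Z, -, -, -, hmain, hmult, hX⟩ := hfeas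
  obtain ⟨E₀, hE₀⟩ : ∃ E : Matrix (Fin nz ⊕ Fin nz) (Fin nz) ℝ, E = Matrix.fromRows 1 0 :=
    ⟨_, rfl⟩
  obtain ⟨E₁, hE₁⟩ : ∃ E : Matrix (Fin nz ⊕ Fin nz) (Fin nz) ℝ, E = Matrix.fromRows 1 1 :=
    ⟨_, rfl⟩
  rw [← hE₀, ← hE₁] at hmult
  have hunit : IsUnit (1 - Dzw).det :=
    isUnit_det_one_sub_of_iqcLMIs hQ hE₁ hmain (hmult Tmin le_rfl hT) hX
  refine ⟨hunit, ?_⟩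
  obtain ⟨V, hV, hVle, hVmin⟩ := hX.exists_partial_minimum
  refine ⟨V, hV, fun k hk₁ hk₂ => ?_⟩
  have hVsymm : V.IsSymm :=
    (Matrix.conjTranspose_eq_transpose_of_trivial V).symm.trans hV.isHermitian
  refine NegDef.of_quad_neg (liftedLMI_isSymm k hVsymm hPsymm _ _ _ _ _ _ _ _) fun v hv => ?_
  -- `d` extends the stacked disturbance by zero; `w t` is the feedback that vanishes in the flow
  -- steps and solves `w = z` in the last one.
  let d : ℕ → Fin nd → ℝ := fun t b => if h : t < k + 1 then v (Sum.inr (⟨t, h⟩, b)) else 0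
  let w : ℕ → (Fin n → ℝ) → Fin nz → ℝ := fun t x =>
    if t < k then 0 else (1 - Dzw)⁻¹ *ᵥ (Cz *ᵥ x + Dzd *ᵥ d t)
  obtain ⟨x, hx₀, hx⟩ := exists_sequence_of_step
    (fun t x => A *ᵥ x + Bw *ᵥ w t x + B *ᵥ d t) (v ∘ Sum.inl)
  obtain ⟨z, hz⟩ : ∃ z : ℕ → Fin nz → ℝ,
      ∀ t, z t = Cz *ᵥ x t + Dzw *ᵥ w t (x t) + Dzd *ᵥ d t := ⟨_, fun _ => rfl⟩
  -- The filter starts at the minimizer that realizes the reduced storage at the initial state.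
  obtain ⟨ξ₀, hξ₀⟩ := hVmin (x 0)
  obtain ⟨ξ, hξi, hξ⟩ := exists_sequence_of_step
    (fun t ξ => AΨ *ᵥ ξ + BΨ *ᵥ Sum.elim (z t) (w t (x t))) ξ₀
  have hw₀ : ∀ t < k, w t (x t) = 0 := fun t ht => by simp [w, ht]
  have hwk : w k (x k) = (1 - Dzw)⁻¹ *ᵥ (Cz *ᵥ x k + Dzd *ᵥ d k) := by simp [w]
  -- At the impulse instant the interconnection is closed by `w = z`.
  have hwz : w k (x k) = z k := by
    have h : (1 - Dzw) *ᵥ w k (x k) = Cz *ᵥ x k + Dzd *ᵥ d k := by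
      rw [hwk, Matrix.mulVec_mulVec, Matrix.mul_nonsing_inv _ hunit, Matrix.one_mulVec]
    rw [Matrix.sub_mulVec, Matrix.one_mulVec, sub_eq_iff_eq_add] at h
    exact h.trans (by rw [hz]; abel)
  have hvd : v = Sum.elim (x 0) fun jb : Fin (k + 1) × Fin nd => d jb.1 jb.2 := by
    ext (i | ⟨j, b⟩)
    · simp [hx₀]
    · simp only [d, Sum.elim_inr]
      rw [dif_pos j.2]
  -- The main LMI, summed along the trajectory.
  have hstep : ∀ t, quad (iqcMainLMI A Bw B Cz Dzw Dzd C Dew D AΨ BΨ CΨ DΨ P X M)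
      (Sum.elim (Sum.elim (ξ t) (x t)) (Sum.elim (w t (x t)) (d t))) =
      quad X (Sum.elim (ξ (t + 1)) (x (t + 1))) - quad X (Sum.elim (ξ t) (x t)) +
        (quad M (CΨ *ᵥ ξ t + DΨ *ᵥ Sum.elim (z t) (w t (x t))) +
          quad P (Sum.elim (C *ᵥ x t + Dew *ᵥ w t (x t) + D *ᵥ d t) (d t))) := fun t => by
    rw [quad_iqcMainLMI (hz := hz t), hξ, hx]
  have hneg : ∑ t ∈ Finset.range (k + 1),
      quad (iqcMainLMI A Bw B Cz Dzw Dzd C Dew D AΨ BΨ CΨ DΨ P X M)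
        (Sum.elim (Sum.elim (ξ t) (x t)) (Sum.elim (w t (x t)) (d t))) < 0 := by
    -- Strictness comes from the first step if the initial state is nonzero, and otherwise from a
    -- step with a nonzero disturbance.
    refine Finset.sum_neg' (fun t _ => hmain.quad_nonpos _) ?_
    by_contra! hcon
    have hall : ∀ t < k + 1, x t = 0 ∧ d t = 0 := fun t ht => by
      have h0 : Sum.elim (Sum.elim (ξ t) (x t)) (Sum.elim (w t (x t)) (d t)) = 0 := by
        by_contra hne
        exact absurd (hmain.quad_neg hne) (hcon t (Finset.mem_range.2 ht)).not_gt
      exact ⟨funext fun i => congrFun h0 (Sum.inl (Sum.inr i)),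
        funext fun i => congrFun h0 (Sum.inr (Sum.inr i))⟩
    refine hv (hvd.trans ?_)
    ext (i | ⟨j, b⟩)
    · simp [(hall 0 (by omega)).1]
    · simp [(hall j j.2).2]
  simp only [hstep, Finset.sum_add_distrib, Finset.sum_range_sub
    (fun t => quad X (Sum.elim (ξ t) (x t)))] at hneg
  -- The multiplier LMI along the filter trajectory.
  have hfilter := (hmult k hk₁ hk₂).quad_nonneg
    (Sum.elim (ξ 0) fun jb : Fin (k + 1) × Fin nz => z jb.1 jb.2)
  have hE₀z : ∀ t < k, Sum.elim (z t) (w t (x t)) = E₀ *ᵥ z t := fun t ht => by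
    simp [hE₀, hw₀ t ht, Matrix.fromRows_mulVec]
  have hE₁z : Sum.elim (z k) (w k (x k)) = E₁ *ᵥ z k := by
    simp [hE₁, hwz, Matrix.fromRows_mulVec]
  rw [quad_liftedLMI (x := ξ) (u := z) _ _ (fun t ht => by
    rw [hξ, hE₀z t ht, Matrix.mulVec_mulVec])] at hfilter
  have hMsum : ∑ t ∈ Finset.range k, quad M (CΨ *ᵥ ξ t + (DΨ * E₀) *ᵥ z t) =
      ∑ t ∈ Finset.range k, quad M (CΨ *ᵥ ξ t + DΨ *ᵥ Sum.elim (z t) (w t (x t))) :=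
    Finset.sum_congr rfl fun t ht => by
      rw [hE₀z t (Finset.mem_range.1 ht), Matrix.mulVec_mulVec]
  rw [hMsum, ← Matrix.mulVec_mulVec, ← Matrix.mulVec_mulVec, ← hE₁z, ← hξ] at hfilter
  -- The jump matrices describe the step with `w = z`.
  rw [Matrix.fromRows_mul, Matrix.fromRows_mul_fromCols, Matrix.fromBlocks_add,
    Matrix.fromBlocks_inj] at hJ
  obtain ⟨rfl, rfl, rfl, rfl⟩ := hJ
  have hjump : ∀ {r : Type} (F : Matrix r (Fin n) ℝ) (G : Matrix r (Fin nd) ℝ)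
      (H : Matrix r (Fin nz) ℝ), (F + H * (1 - Dzw)⁻¹ * Cz) *ᵥ x k +
        (G + H * (1 - Dzw)⁻¹ * Dzd) *ᵥ d k = F *ᵥ x k + H *ᵥ w k (x k) + G *ᵥ d k :=
    fun F G H => by
      rw [hwk]
      simp only [Matrix.add_mulVec, Matrix.mulVec_add, Matrix.mulVec_mulVec, Matrix.mul_assoc]
      abel
  rw [hvd, quad_liftedLMI (x := x) (u := d) _ _ (fun t ht => by rw [hx, hw₀ t ht]; simp)]
  have hPsum : ∑ t ∈ Finset.range k,
      quad P (Matrix.fromRows C 0 *ᵥ x t + Matrix.fromRows D 1 *ᵥ d t) =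
      ∑ t ∈ Finset.range k,
        quad P (Sum.elim (C *ᵥ x t + Dew *ᵥ w t (x t) + D *ᵥ d t) (d t)) :=
    Finset.sum_congr rfl fun t ht => by
      rw [hw₀ t (Finset.mem_range.1 ht), Matrix.fromRows_mulVec, Matrix.fromRows_mulVec,
        ← Sum.elim_add_add]
      simp
  rw [hPsum, Matrix.fromRows_mulVec, Matrix.fromRows_mulVec, ← Sum.elim_add_add, hjump, hjump,
    ← hx, Matrix.zero_mulVec, Matrix.one_mulVec, zero_add]
  -- The reduced storage bounds the full one from below at the end of the period.
  have hend := hVle (ξ (k + 1)) (x (k + 1))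
  rw [quad_sub, quad_fromBlocks_diagonal, quad_zero_left] at hend hξ₀
  rw [← hξi] at hξ₀
  rw [Finset.sum_range_succ, Finset.sum_range_succ] at hneg
  linarith
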